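/- Let $a,b,c,d,e\in\mathbb{R}$ with $ac\neq0$, and put $A(z)=az+b$, $B(z)=cz^2+dz+e$. Let $(W_n(z))_{n\ge0}$ be a sequence of polynomials with complex coefficients satisfying $$W_n(z)=A(z)W_{n-1}(z)+B(z)W_{n-2}(z)\qquad(n\ge2),$$ and assume that the sequence is general, that is: the polynomial $W_1^2-AW_0W_1-BW_0^2$ is not identically zero; $A$ and $B$ have no common zero in $\mathbb{C}$; $W_0$ and $W_1$ have no common zero in $\mathbb{C}$. A number $z^*\in\mathbb{C}$ is a limit of zeros of $(W_n)$ if there are $z_n\in\mathbb{C}$ with $z_n\to z^*$ and $W_n(z_n)=0$ for all sufficiently large $n$. Let $\clubsuit$ be the set of non-isolated limits of zeros, that is, of those limits of zeros that are not isolated points of the set of all limits of zeros. Write $\Delta(z)=A(z)^2+4B(z)$, $x_A=-b/a$, $\Delta_\Delta=16\bigl(d^2-4ce-a^2B(x_A)\bigr)$, $J_\Delta=\{x\in\mathbb{R}:\Delta(x)\le0\}$ and, when $a^2+4c\ne0$, $$x_\Delta^{\pm}=\frac{-ab-2d}{a^2+4c}\pm\frac{\sqrt{\Delta_\Delta}}{2|a^2+4c|},$$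 where $\sqrt{\cdot}$ is the principal square root. When $B'(x_A)\neq0$, put $r=B(x_A)/B'(x_A)$ and $x_C=x_A-2r$. Let $C_0$ be the circle $\{z\in\mathbb{C}:|z-x_A+r|=|r|\}$ if $B'(x_A)\ne0$, and the line $\{z\in\mathbb{C}:\operatorname{Re}z=x_A\}$ if $B'(x_A)=0$. For points $p,q,s$, let $\wideparen{pqs}$ be the closed circular arc from $p$ through $q$ to $s$; if $q$ lies on the segment from $p$ to $s$, it is that segment. 1. If $\Delta_\Delta<0$, then the zeros of $\Delta(z)$ are exactly $x_\Delta^-$ and $x_\Delta^+$, and $$\clubsuit=\begin{cases}\wideparen{x_\Delta^-x_Ax_\Delta^+},&\text{if }a^2+4c>0,\\ \wideparen{x_\Delta^-x_Cx_\Delta^+}\cup\mathbb{R},&\text{if }a^2+4c<0.\end{cases}$$ Here, when $B'(x_A)=0$, $x_C$ is understood as the point at infinity and $\wideparen{x_\Delta^-x_Cx_\Delta^+}$ as the line through $x_\Delta^-$ and $x_\Delta^+$ with the open segment between them removed (a union of two rays). 2. If $\Delta_\Delta\ge0$, then $$\clubsuit=\begin{cases}J_\Delta,&\text{if }B(x_A)<0,\\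 J_\Delta\cup C_0,&\text{if }B(x_A)>0.\end{cases}$$ -/

import Mathlib

open Polynomial Filter Topology

noncomputable section

namespace ClubSet

/-- `A(z) = a z + b`. -/
def polyA (a b : ℝ) : ℝ[X] := C a * X + C b

/-- `B(z) = c z ^ 2 + d z + e`. -/
def polyB (c d e : ℝ) : ℝ[X] := C c * X ^ 2 + C d * X + C e

/-- `Δ(z) = A(z) ^ 2 + 4 B(z)`. -/
def polyDelta (a b c d e : ℝ) : ℝ[X] := polyA a b ^ 2 + 4 * polyB c d e

/-- A general sequence of polynomials: it satisfies the recurrence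
`W_n = (a z + b) W_{n-1} + (c z ^ 2 + d z + e) W_{n-2}` for `n ≥ 2`, the polynomial
`W_1 ^ 2 - A W_0 W_1 - B W_0 ^ 2` is not identically zero, `A` and `B` do not share a zero in `ℂ`,
and `W_0` and `W_1` do not share a zero in `ℂ`. -/
structure IsGeneral (a b c d e : ℝ) (W : ℕ → ℂ[X]) : Prop where
  recurrence : ∀ n, W (n + 2) = (polyA a b).map (algebraMap ℝ ℂ) * W (n + 1) +
    (polyB c d e).map (algebraMap ℝ ℂ) * W n
  not_first_order : W 1 ^ 2 - (polyA a b).map (algebraMap ℝ ℂ) * W 0 * W 1 -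
    (polyB c d e).map (algebraMap ℝ ℂ) * W 0 ^ 2 ≠ 0
  no_common_zero_coeff : ∀ z : ℂ, ¬ (aeval z (polyA a b) = 0 ∧ aeval z (polyB c d e) = 0)
  no_common_zero_init : ∀ z : ℂ, ¬ ((W 0).IsRoot z ∧ (W 1).IsRoot z)

/-- The limits of zeros of a sequence of polynomials: the limits of sequences `(z_n)` such that
`z_n` is a zero of `W_n` for all sufficiently large `n` (some initial `W_n` may be constant). -/
def limitsOfZeros (W : ℕ → ℂ[X]) : Set ℂ :=
  {w | ∃ z : ℕ → ℂ, (∀ᶠ n in atTop, (W n).IsRoot (z n)) ∧ Tendsto z atTop (𝓝 w)}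

/-- The set `♣` of non-isolated limits of zeros: the limits of zeros that are not isolated points
of the set of all limits of zeros. -/
def nonIsolatedLimits (W : ℕ → ℂ[X]) : Set ℂ :=
  {w | w ∈ limitsOfZeros W ∧ AccPt w (𝓟 (limitsOfZeros W))}

/-- The zero `x_A = -b / a` of `A`. -/
def xA (a b : ℝ) : ℝ := -b / a

/-- `B(x_A)`. -/
def BxA (a b c d e : ℝ) : ℝ := (polyB c d e).eval (xA a b)

/-- `B'(x_A)`. -/
def BxA' (a b c d e : ℝ) : ℝ := (polyB c d e).derivative.eval (xA a b)

/-- `Δ_Δ = 16 (Δ_B - a ^ 2 B(x_A))` with `Δ_B = d ^ 2 - 4 c e`. -/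
def discDelta (a b c d e : ℝ) : ℝ := 16 * ((d ^ 2 - 4 * c * e) - a ^ 2 * BxA a b c d e)

/-- `x_Δ⁺` in the case `a ^ 2 + 4 c ≠ 0`. The power `1 / 2` is the principal square root. -/
def xDeltaPlus (a b c d e : ℝ) : ℂ :=
  ((-a * b - 2 * d) / (a ^ 2 + 4 * c) : ℝ) +
    (discDelta a b c d e : ℂ) ^ (1 / 2 : ℂ) / (2 * |a ^ 2 + 4 * c| : ℝ)

/-- `x_Δ⁻` in the case `a ^ 2 + 4 c ≠ 0`. The power `1 / 2` is the principal square root. -/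
def xDeltaMinus (a b c d e : ℝ) : ℂ :=
  ((-a * b - 2 * d) / (a ^ 2 + 4 * c) : ℝ) -
    (discDelta a b c d e : ℂ) ^ (1 / 2 : ℂ) / (2 * |a ^ 2 + 4 * c| : ℝ)

/-- `r = B(x_A) / B'(x_A)`, meaningful when `B'(x_A) ≠ 0`. -/
def radius (a b c d e : ℝ) : ℝ := BxA a b c d e / BxA' a b c d e

/-- `x_C = x_A - 2 r`, meaningful when `B'(x_A) ≠ 0`. -/
def xC (a b c d e : ℝ) : ℝ := xA a b - 2 * radius a b c d e

open Classical in
/-- The closed circular arc from `p` through `q` to `s`: the points of the circle through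
`p`, `q`, `s` that are not strictly on the other side of the line `ps` from `q`. If `q` lies on the
line `ps` (it is then between `p` and `s` in the use below), the arc degenerates to the segment
from `p` to `s`. -/
def arc (p q s : ℂ) : Set ℂ :=
  if Collinear ℝ {p, q, s} then segment ℝ p s
  else {z | EuclideanGeometry.Cospherical {p, q, s, z} ∧ line[ℝ, p, s].WSameSide q z}

/-- The arc from `p` through the point at infinity to `s`: the line `ps` without the points
strictly between `p` and `s`, that is, a union of two closed rays. -/
def arcThroughInfinity (p s : ℂ) : Set ℂ :=
  {z | z ∈ line[ℝ, p, s] ∧ ¬ Sbtw ℝ p z s}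

/-- The arc from `x_Δ⁻` through `x_C` to `x_Δ⁺`; if `B'(x_A) = 0`, then `x_C` is the point at
infinity and the arc degenerates to two rays. -/
def arcC (a b c d e : ℝ) : Set ℂ :=
  if BxA' a b c d e = 0 then
    arcThroughInfinity (xDeltaMinus a b c d e) (xDeltaPlus a b c d e)
  else arc (xDeltaMinus a b c d e) (xC a b c d e : ℂ) (xDeltaPlus a b c d e)

/-- `J_Δ = {x ∈ ℝ : Δ(x) ≤ 0}`, as a subset of `ℂ`. -/
def JDelta (a b c d e : ℝ) : Set ℂ :=
  (fun x : ℝ => (x : ℂ)) '' {x : ℝ | (polyDelta a b c d e).eval x ≤ 0}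

/-- The circle `C₀`: `|z - x_A + r| = |r|`, or the line `Re z = x_A` when `B'(x_A) = 0`. -/
def C0 (a b c d e : ℝ) : Set ℂ :=
  if BxA' a b c d e ≠ 0 then
    {z : ℂ | ‖z - (xA a b : ℂ) + (radius a b c d e : ℂ)‖ = |radius a b c d e|}
  else {z : ℂ | z.re = xA a b}

end ClubSet

end

open Polynomial Filter Topology

noncomputable section

namespace ClubSet

/-! This is the Beraha-Kahane-Weiss principle made explicit. Let `l`, `m` be the roots of `λ ^ 2 =
A(z) λ + B(z)`. Then `(l - m) W_n = l ^ n (W_1 - m W_0) - m ^ n (W_1 - l W_0)`, and the product of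
the two coefficients is `P = W_1 ^ 2 - A W_0 W_1 - B W_0 ^ 2`. Where one root dominates, a limit of
zeros must kill its coefficient, hence `P`; this leaves finitely many points. Where the moduli
agree, the two terms can cancel, and zeros accumulate.

So `♣` is the equimodular set `E` (`nonIsolatedLimits_eq`). Here `|l| = |m|` means that `(l + m) ^ 2
/ (l m) = -A ^ 2 / B` lies in `[0, 4]`, which gives the form used for `equimodularSet`. The
inclusion of `E` rests on `mem_limitsOfZeros_of_generic`, valid off a finite set, together with the
facts that `E` has no isolated points and that the limits of zeros form a closed set.

What remains is real geometry (`mem_equimodularSet_iff`). On the real axis `E` is `Δ ≤ 0` together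
with `x_A`; off it, `E` is the part of `C₀` where `(a ^ 2 + 4 c) |z - x_A| ^ 2 ≤ 4 B(x_A)`. The sign
of `Δ_Δ` decides whether this inequality keeps all of `C₀`, none of it, or an arc. -/

/-! ### Characteristic roots, and limits of zeros off the equimodular set. -/

theorem eval_map_polyA (a b : ℝ) (z : ℂ) :
    ((polyA a b).map (algebraMap ℝ ℂ)).eval z = a * z + b := by
  simp [polyA]

theorem eval_map_polyB (c d e : ℝ) (z : ℂ) :
    ((polyB c d e).map (algebraMap ℝ ℂ)).eval z = c * z ^ 2 + d * z + e := by
  simp [polyB]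

/-- The points at which the two roots of `λ ^ 2 = A(z) λ + B(z)` have the same modulus. -/
def equimodularSet (a b c d e : ℝ) : Set ℂ :=
  {z | ∃ s ∈ Set.Icc (0 : ℝ) 4, (a * z + b : ℂ) ^ 2 = -s * (c * z ^ 2 + d * z + e)}

/-- The polynomial `W_1 ^ 2 - A W_0 W_1 - B W_0 ^ 2`. -/
def initForm (a b c d e : ℝ) (W : ℕ → ℂ[X]) : ℂ[X] :=
  W 1 ^ 2 - (polyA a b).map (algebraMap ℝ ℂ) * W 0 * W 1 -
    (polyB c d e).map (algebraMap ℝ ℂ) * W 0 ^ 2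

theorem sub_mul_of_recurrence {A B l m : ℂ} {w : ℕ → ℂ}
    (hw : ∀ n, w (n + 2) = A * w (n + 1) + B * w n) (hA : l + m = A) (hB : l * m = -B) (n : ℕ) :
    (l - m) * w n = l ^ n * (w 1 - m * w 0) - m ^ n * (w 1 - l * w 0) := by
  induction n using Nat.twoStepInduction with
  | zero => ring
  | one => ring
  | more n h0 h1 =>
    have hB' : B = -(l * m) := by rw [hB, neg_neg]
    rw [hw, ← hA, hB']
    linear_combination (l + m) * h1 - l * m * h0

theorem mul_eq_initForm {a b c d e : ℝ} (W : ℕ → ℂ[X]) {z l m : ℂ}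
    (hA : l + m = a * z + b) (hB : l * m = -(c * z ^ 2 + d * z + e)) :
    ((W 1).eval z - m * (W 0).eval z) * ((W 1).eval z - l * (W 0).eval z) =
      (initForm a b c d e W).eval z := by
  simp only [initForm, eval_sub, eval_mul, eval_pow, eval_map_polyA, eval_map_polyB]
  linear_combination -((W 0).eval z * (W 1).eval z) * hA + (W 0).eval z ^ 2 * hB

theorem IsGeneral.eval_recurrence {a b c d e : ℝ} {W : ℕ → ℂ[X]} (hW : IsGeneral a b c d e W)
    (z : ℂ) (n : ℕ) : (W (n + 2)).eval z =
      (a * z + b) * (W (n + 1)).eval z + (c * z ^ 2 + d * z + e) * (W n).eval z := by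
  rw [hW.recurrence]
  simp only [eval_add, eval_mul, eval_map_polyA, eval_map_polyB]

theorem IsGeneral.not_both_zero {a b c d e : ℝ} {W : ℕ → ℂ[X]} (hW : IsGeneral a b c d e W)
    {z : ℂ} (hA : (a * z + b : ℂ) = 0) : (c * z ^ 2 + d * z + e : ℂ) ≠ 0 := by
  intro hB
  refine hW.no_common_zero_coeff z ⟨?_, ?_⟩
  · rw [← hA, ← eval_map_polyA, eval_map_algebraMap]
  · rw [← hB, ← eval_map_polyB, eval_map_algebraMap]

/-- If the two characteristic roots have distinct moduli at a limit of zeros, then the coefficient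
of the dominant one vanishes there. -/
theorem eval_initForm_eq_zero_of_norm_lt {a b c d e : ℝ} {W : ℕ → ℂ[X]}
    (hW : IsGeneral a b c d e W) {w : ℂ} (hw : w ∈ limitsOfZeros W) {l m : ℂ → ℂ}
    (hl : ContinuousAt l w) (hm : ContinuousAt m w) (hA : ∀ z, l z + m z = a * z + b)
    (hB : ∀ z, l z * m z = -(c * z ^ 2 + d * z + e)) (hlt : ‖m w‖ < ‖l w‖) :
    (initForm a b c d e W).eval w = 0 := by
  obtain ⟨z, hz, hzw⟩ := hw
  have hl0 : l w ≠ 0 := norm_pos_iff.1 ((norm_nonneg _).trans_lt hlt)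
  have hlz : Tendsto (fun n => l (z n)) atTop (𝓝 (l w)) := hl.tendsto.comp hzw
  have hmz : Tendsto (fun n => m (z n)) atTop (𝓝 (m w)) := hm.tendsto.comp hzw
  have hev (i : ℕ) : Tendsto (fun n => (W i).eval (z n)) atTop (𝓝 ((W i).eval w)) :=
    (W i).continuous.continuousAt.tendsto.comp hzw
  have hratio : Tendsto (fun n => ‖m (z n) / l (z n)‖) atTop (𝓝 ‖m w / l w‖) :=
    (hmz.div hlz hl0).norm
  have hlt1 : ‖m w / l w‖ < 1 := by
    rw [norm_div, div_lt_one (norm_pos_iff.2 hl0)]; exact hlt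
  obtain ⟨k, hk, hk1⟩ := exists_between hlt1
  have hk0 : 0 ≤ k := (norm_nonneg _).trans hk.le
  have hpow : Tendsto (fun n => (m (z n) / l (z n)) ^ n) atTop (𝓝 0) := by
    apply squeeze_zero_norm' (a := fun n => k ^ n) _ (tendsto_pow_atTop_nhds_zero_of_lt_one hk0 hk1)
    filter_upwards [hratio.eventually_lt_const hk] with n hn
    rw [norm_pow]
    exact pow_le_pow_left₀ (norm_nonneg _) hn.le n
  -- Since `W_n(z_n) = 0`, the dominant coefficient equals `(m / l) ^ n` times the other one, which
  -- is bounded.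
  have h1 : Tendsto (fun n => (W 1).eval (z n) - m (z n) * (W 0).eval (z n)) atTop (𝓝 0) := by
    have h2 := hpow.mul ((hev 1).sub (hlz.mul (hev 0)))
    rw [zero_mul] at h2
    refine h2.congr' ?_
    filter_upwards [hz, hlz.eventually_ne hl0] with n hn hn0
    have h3 := sub_mul_of_recurrence (w := fun i => (W i).eval (z n)) (hW.eval_recurrence (z n))
      (hA (z n)) (hB (z n)) n
    rw [show (W n).eval (z n) = 0 from hn, mul_zero] at h3
    rw [div_pow, div_mul_eq_mul_div, div_eq_iff (pow_ne_zero n hn0)]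
    linear_combination h3
  have h4 := tendsto_nhds_unique h1 ((hev 1).sub (hmz.mul (hev 0)))
  rw [← mul_eq_initForm W (hA w) (hB w), ← h4, zero_mul]

/-- The quotient `t = l / m` lies on the unit circle, so `A ^ 2 / (-B) = t + 2 + 1 / t = 2 + 2 Re
t`. Neither root vanishes, because `A` and `B` have no common zero. -/
theorem mem_equimodularSet_of_norm_eq {a b c d e : ℝ} {W : ℕ → ℂ[X]}
    (hW : IsGeneral a b c d e W) {z l m : ℂ}
    (hA : l + m = a * z + b) (hB : l * m = -(c * z ^ 2 + d * z + e)) (h : ‖l‖ = ‖m‖) :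
    z ∈ equimodularSet a b c d e := by
  have hm : m ≠ 0 := by
    rintro rfl
    rw [norm_zero, norm_eq_zero] at h
    subst h
    refine hW.not_both_zero (z := z) ?_ ?_
    · rw [← hA, add_zero]
    · rw [← neg_eq_zero, ← hB, mul_zero]
  have ht : ‖l / m‖ = 1 := by rw [norm_div, h, div_self (norm_ne_zero_iff.2 hm)]
  have hre := abs_le.1 ((Complex.abs_re_le_norm (l / m)).trans_eq ht)
  have hl : l ≠ 0 := norm_ne_zero_iff.1 (h ▸ norm_ne_zero_iff.2 hm)
  refine ⟨2 + 2 * (l / m).re, ⟨by linarith, by linarith⟩, ?_⟩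
  have hinv : (l / m)⁻¹ = (starRingEnd ℂ) (l / m) := by
    rw [Complex.inv_def, Complex.normSq_eq_norm_sq, ht]; simp
  have hs : ((2 + 2 * (l / m).re : ℝ) : ℂ) = 2 + (l / m + m / l) := by
    rw [← inv_div l m, hinv, Complex.add_conj]; push_cast; ring
  rw [hs, ← hA, neg_mul_comm, ← hB]
  field_simp
  ring

theorem eval_initForm_eq_zero {a b c d e : ℝ} {W : ℕ → ℂ[X]}
    (hW : IsGeneral a b c d e W) {w : ℂ} (hw : w ∈ limitsOfZeros W)
    (hE : w ∉ equimodularSet a b c d e) : (initForm a b c d e W).eval w = 0 := by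
  set D : ℂ → ℂ := fun z => (a * z + b) ^ 2 + 4 * (c * z ^ 2 + d * z + e) with hD
  have hD0 : D w ≠ 0 := by
    intro h
    refine hE ⟨4, ⟨by norm_num, le_rfl⟩, ?_⟩
    push_cast
    linear_combination h
  obtain ⟨s, hs⟩ := IsAlgClosed.exists_eq_mul_self (D w)
  -- A square root of `Δ` continuous at `w`: dividing by `D w` moves the argument of the principal
  -- root near `1`, away from its cut.
  set S : ℂ → ℂ := fun z => s * (D z / D w) ^ (1 / 2 : ℂ) with hS
  have hSq (z : ℂ) : S z ^ 2 = D z := by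
    have h1 : ((D z / D w) ^ (1 / 2 : ℂ)) ^ 2 = D z / D w := by
      have := Complex.cpow_nat_inv_pow (D z / D w) (n := 2) two_ne_zero
      rwa [Nat.cast_ofNat, ← one_div] at this
    simp only [hS]
    rw [mul_pow, h1, pow_two, ← hs, mul_div_cancel₀ _ hD0]
  have hDc : ContinuousAt D w := by fun_prop
  have hSc : ContinuousAt S w := by
    refine continuousAt_const.mul ((hDc.div_const _).cpow continuousAt_const ?_)
    rw [div_self hD0]; exact Complex.one_mem_slitPlane
  have hlc : ContinuousAt (fun z => (a * z + b + S z) / 2) w := by fun_prop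
  have hmc : ContinuousAt (fun z => (a * z + b - S z) / 2) w := by fun_prop
  have hsum (z : ℂ) : (a * z + b + S z) / 2 + (a * z + b - S z) / 2 = a * z + b := by ring
  have hprod (z : ℂ) : (a * z + b + S z) / 2 * ((a * z + b - S z) / 2) =
      -(c * z ^ 2 + d * z + e) := by
    have := hSq z
    simp only [hD] at this
    linear_combination -this / 4
  rcases lt_trichotomy ‖(a * w + b + S w) / 2‖ ‖(a * w + b - S w) / 2‖ with h | h | h
  · exact eval_initForm_eq_zero_of_norm_lt hW hw hmc hlc (fun z => by rw [add_comm, hsum])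
      (fun z => by rw [mul_comm, hprod]) h
  · exact absurd (mem_equimodularSet_of_norm_eq hW (hsum w) (hprod w) h) hE
  · exact eval_initForm_eq_zero_of_norm_lt hW hw hlc hmc hsum hprod h

/-! ### Topology of the limits of zeros. -/

/-- Conversely, one takes for each `n` a zero of `W_n` whose distance to `w` exceeds the infimum by
less than `1 / (n + 1)`. -/
theorem mem_limitsOfZeros_iff {W : ℕ → ℂ[X]} {w : ℂ} :
    w ∈ limitsOfZeros W ↔ ∀ U ∈ 𝓝 w, ∀ᶠ n in atTop, ∃ z ∈ U, (W n).IsRoot z := by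
  constructor
  · rintro ⟨z, hz, hzw⟩ U hU
    filter_upwards [hz, hzw hU] with n h1 h2 using ⟨z n, h2, h1⟩
  · intro h
    have hex (n : ℕ) : ∃ z : ℂ, (∃ y, (W n).IsRoot y) →
        (W n).IsRoot z ∧ dist w z < Metric.infDist w {y | (W n).IsRoot y} + 1 / ((n : ℝ) + 1) := by
      by_cases hn : ∃ y, (W n).IsRoot y
      · obtain ⟨z, hz, hz'⟩ := (Metric.infDist_lt_iff (s := {y | (W n).IsRoot y}) hn).1
          (lt_add_of_pos_right (Metric.infDist w _) (Nat.one_div_pos_of_nat (α := ℝ) (n := n)))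
        exact ⟨z, fun _ => ⟨hz, hz'⟩⟩
      · exact ⟨0, fun h => absurd h hn⟩
    choose z hz using hex
    have hne : ∀ᶠ n in atTop, ∃ y, (W n).IsRoot y :=
      (h Set.univ univ_mem).mono fun n ⟨y, _, hy⟩ => ⟨y, hy⟩
    refine ⟨z, hne.mono fun n hn => (hz n hn).1, ?_⟩
    rw [Metric.tendsto_nhds]
    intro ε hε
    filter_upwards [hne, h _ (Metric.ball_mem_nhds w (half_pos hε)),
      (tendsto_one_div_add_atTop_nhds_zero_nat (𝕜 := ℝ)).eventually_lt_const (half_pos hε)]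
      with n h1 h2 h3
    obtain ⟨y, hy, hyr⟩ := h2
    have h4 : Metric.infDist w {y | (W n).IsRoot y} ≤ dist w y := Metric.infDist_le_dist_of_mem hyr
    rw [Metric.mem_ball, dist_comm] at hy
    rw [dist_comm]
    linarith [(hz n h1).2]

theorem isClosed_limitsOfZeros (W : ℕ → ℂ[X]) : IsClosed (limitsOfZeros W) := by
  refine isClosed_of_closure_subset fun w hw => mem_limitsOfZeros_iff.2 fun U hU => ?_
  obtain ⟨v, hvU, hv⟩ := mem_closure_iff_nhds.1 hw _ (interior_mem_nhds.2 hU)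
  exact mem_limitsOfZeros_iff.1 hv U (mem_interior_iff_mem_nhds.1 hvU)

/-! ### Zeros accumulate at generic equimodular points. -/

/-- Solutions of `exp (2 n i φ) = exp (G φ)` accumulate at every real point. -/
theorem eventually_exists_exp_eq {G : ℂ → ℂ} {p : ℝ} (hG : ContDiffAt ℂ 1 G p) {U : Set ℂ}
    (hU : U ∈ 𝓝 (p : ℂ)) :
    ∀ᶠ n : ℕ in atTop, ∃ x ∈ U, Complex.exp (2 * n * Complex.I * x) = Complex.exp (G x) := by
  obtain ⟨K, t, ht, hK⟩ := hG.exists_lipschitzOnWith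
  obtain ⟨r, hr, hrU⟩ := Metric.nhds_basis_closedBall.mem_iff.1 (inter_mem hU ht)
  have hbig := tendsto_natCast_atTop_atTop (R := ℝ)
  filter_upwards [hbig.eventually_gt_atTop 0, hbig.eventually_ge_atTop (K : ℝ),
    hbig.eventually_ge_atTop ((Real.pi + (‖G p‖ + K * r) / 2) / r)] with n hn0 hnK hnr
  have hnC : (n : ℂ) ≠ 0 := by exact_mod_cast hn0.ne'
  set k : ℤ := ⌊n * p / Real.pi⌋
  -- A fixed point of `T` solves the equation. The choice of `k` puts `π k / n` within `π / n` of
  -- `p`, so `T` preserves a small ball for large `n`; its Lipschitz constant `K / (2 n)` is at most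
  -- `1 / 2`.
  set T : ℂ → ℂ := fun x => (G x + k * (2 * Real.pi * Complex.I)) / (2 * n * Complex.I) with hT
  have hden : ‖(2 * n * Complex.I : ℂ)‖ = 2 * n := by simp
  have hk : ‖(Real.pi * k / n : ℝ) - p‖ ≤ Real.pi / n := by
    have h1 := Int.floor_le (n * p / Real.pi)
    have h2 := Int.lt_floor_add_one (n * p / Real.pi)
    rw [le_div_iff₀ Real.pi_pos] at h1
    rw [div_lt_iff₀ Real.pi_pos] at h2
    have h3 : Real.pi * k / n - p = (k * Real.pi - n * p) / n := by field_simp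
    rw [h3, norm_div, Real.norm_of_nonneg hn0.le]
    gcongr
    rw [Real.norm_eq_abs, abs_le]
    constructor <;> nlinarith [Real.pi_pos]
  have hmaps : Set.MapsTo T (Metric.closedBall p r) (Metric.closedBall p r) := by
    intro x hx
    have hGx : ‖G x‖ ≤ ‖G p‖ + K * r := by
      have h1 := hK.dist_le_mul x (hrU hx).2 p (mem_of_mem_nhds ht)
      have h2 : (K : ℝ) * dist x p ≤ K * r := by gcongr; exact hx
      rw [dist_eq_norm] at h1
      linarith [norm_le_norm_add_norm_sub' (G x) (G p)]
    have hsplit : T x - p = G x / (2 * n * Complex.I) + (((Real.pi * k / n : ℝ) - p : ℝ) : ℂ) := by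
      simp only [hT]
      push_cast
      have := Complex.I_ne_zero
      field_simp
      ring
    rw [Metric.mem_closedBall, dist_eq_norm, hsplit]
    refine (norm_add_le _ _).trans ?_
    rw [norm_div, hden, Complex.norm_real]
    have h5 : ‖G x‖ / (2 * n) ≤ (‖G p‖ + K * r) / (2 * n) := by gcongr
    have h6 : (Real.pi + (‖G p‖ + K * r) / 2) / n ≤ r := by
      rw [div_le_iff₀ hr] at hnr
      rw [div_le_iff₀ hn0]; linarith
    have h7 : (‖G p‖ + K * r) / (2 * n) + Real.pi / n =
      (Real.pi + (‖G p‖ + K * r) / 2) / n := by field_simp; ring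
    linarith
  have hcontr : ContractingWith 2⁻¹ (hmaps.restrict T _ _) := by
    refine ⟨by rw [← NNReal.coe_lt_coe]; norm_num, LipschitzWith.of_dist_le_mul fun x y => ?_⟩
    have h1 := hK.dist_le_mul x (hrU x.2).2 y (hrU y.2).2
    rw [Subtype.dist_eq, Subtype.dist_eq]
    simp only [Set.MapsTo.val_restrict_apply, hT]
    rw [dist_eq_norm, ← sub_div, add_sub_add_right_eq_sub, norm_div, hden, ← dist_eq_norm,
      div_le_iff₀ (by positivity)]
    have h2 : (K : ℝ) * dist (x : ℂ) y ≤ n * dist (x : ℂ) y := by gcongr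
    push_cast
    linarith
  obtain ⟨x, hx, hfix, -⟩ := hcontr.exists_fixedPoint' Metric.isClosed_closedBall.isComplete hmaps
    (Metric.mem_closedBall_self hr.le) (edist_ne_top _ _)
  refine ⟨x, (hrU hx).1, ?_⟩
  have h8 : 2 * n * Complex.I * x = G x + k * (2 * Real.pi * Complex.I) := by
    have h9 : T x = x := hfix
    simp only [hT] at h9
    rw [div_eq_iff (by simp [hnC])] at h9
    rw [h9]; ring
  rw [h8, Complex.exp_periodic.int_mul k]

theorem exists_contDiffAt_rightInverse {f : ℂ → ℂ} {f' x : ℂ} (hf : ContDiffAt ℂ 1 f x)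
    (hd : HasDerivAt f f' x) (h0 : f' ≠ 0) :
    ∃ ψ : ℂ → ℂ, ContDiffAt ℂ 1 ψ (f x) ∧ ψ (f x) = x ∧ ∀ᶠ y in 𝓝 (f x), f (ψ y) = y := by
  have hd' : HasFDerivAt f
      (ContinuousLinearEquiv.unitsEquivAut ℂ (Units.mk0 f' h0) : ℂ →L[ℂ] ℂ) x := by
    have h : (ContinuousLinearEquiv.unitsEquivAut ℂ (Units.mk0 f' h0) : ℂ →L[ℂ] ℂ) =
        ContinuousLinearMap.toSpanSingleton ℂ f' := by
      ext; simp
    rw [h]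
    exact hd.hasFDerivAt
  refine ⟨hf.localInverse hd' one_ne_zero, hf.to_localInverse hd' one_ne_zero,
    hf.localInverse_apply_image hd' one_ne_zero, ?_⟩
  exact (hf.toOpenPartialHomeomorph f hd' one_ne_zero).eventually_right_inverse
    (hf.image_mem_toOpenPartialHomeomorph_target hd' one_ne_zero)

theorem contDiffAt_charRatio {a b c d e : ℝ} {z : ℂ} (hB : (c * z ^ 2 + d * z + e : ℂ) ≠ 0)
    (n : WithTop ℕ∞) :
    ContDiffAt ℂ n (fun z : ℂ => -(a * z + b) ^ 2 / (c * z ^ 2 + d * z + e)) z := by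
  fun_prop (disch := exact hB)

theorem hasDerivAt_charRatio {a b c d e : ℝ} {z : ℂ} (hB : (c * z ^ 2 + d * z + e : ℂ) ≠ 0) :
    HasDerivAt (fun z : ℂ => -(a * z + b) ^ 2 / (c * z ^ 2 + d * z + e))
      (-((a * z + b) * (2 * a * (c * z ^ 2 + d * z + e) - (a * z + b) * (2 * c * z + d))) /
        (c * z ^ 2 + d * z + e) ^ 2) z := by
  have hid := hasDerivAt_id z
  have h1 : HasDerivAt (fun z : ℂ => a * z + b) (a * 1 : ℂ) z := (hid.const_mul (a : ℂ)).add_const _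
  have h2 : HasDerivAt (fun z : ℂ => c * z ^ 2 + d * z + e) (c * (2 * z) + d * 1 : ℂ) z := by
    have := (((hasDerivAt_pow 2 z).const_mul (c : ℂ)).add (hid.const_mul (d : ℂ))).add_const (e : ℂ)
    simpa using this
  refine ((h1.pow 2).neg.div h2 hB).congr_deriv ?_
  simp
  ring

/-- A point of the equimodular set is a limit of zeros, if none of finitely many polynomials
vanishes there. -/
theorem mem_limitsOfZeros_of_generic {a b c d e : ℝ} {W : ℕ → ℂ[X]} (hW : IsGeneral a b c d e W)
    {z₀ : ℂ} (hE : z₀ ∈ equimodularSet a b c d e) (hA : (a * z₀ + b : ℂ) ≠ 0)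
    (hD : ((a * z₀ + b) ^ 2 + 4 * (c * z₀ ^ 2 + d * z₀ + e) : ℂ) ≠ 0)
    (hJ : (2 * a * (c * z₀ ^ 2 + d * z₀ + e) - (a * z₀ + b) * (2 * c * z₀ + d) : ℂ) ≠ 0)
    (hP : (initForm a b c d e W).eval z₀ ≠ 0) : z₀ ∈ limitsOfZeros W := by
  obtain ⟨s, ⟨hs0, hs4⟩, hs⟩ := hE
  have hB : (c * z₀ ^ 2 + d * z₀ + e : ℂ) ≠ 0 := by
    intro h
    rw [h, mul_zero] at hs
    exact hA (pow_eq_zero_iff two_ne_zero |>.1 hs)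
  have hs0' : 0 < s := by
    refine hs0.lt_of_ne' ?_
    rintro rfl
    rw [Complex.ofReal_zero, neg_zero, zero_mul] at hs
    exact hA (pow_eq_zero_iff two_ne_zero |>.1 hs)
  have hs4' : s < 4 := by
    refine hs4.lt_of_ne ?_
    rintro rfl
    push_cast at hs
    exact hD (by linear_combination hs)
  set f : ℂ → ℂ := fun z => -(a * z + b) ^ 2 / (c * z ^ 2 + d * z + e) with hf
  have hfs : f z₀ = s := by
    simp only [hf]
    rw [div_eq_iff hB]
    linear_combination -hs
  -- The derivative of `f` is `-A (2 a B - A B') / B ^ 2`, nonzero by `hA` and `hJ`.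
  obtain ⟨ψ, hψ, hψ0, hψr⟩ := exists_contDiffAt_rightInverse (contDiffAt_charRatio hB 1)
    (hasDerivAt_charRatio (a := a) (b := b) hB)
    (div_ne_zero (neg_ne_zero.2 (mul_ne_zero hA hJ)) (pow_ne_zero 2 hB))
  change ContDiffAt ℂ 1 ψ (f z₀) at hψ
  change ψ (f z₀) = z₀ at hψ0
  change ∀ᶠ y in 𝓝 (f z₀), f (ψ y) = y at hψr
  rw [hfs] at hψ hψ0 hψr
  -- Thus `4 cos ^ 2 p = s`. In the coordinate `x` near `p`, defined by `f (ζ x) = 4 cos ^ 2 x`, the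
  -- characteristic roots are `ρ e ^ (± i x)` with `2 ρ cos x = A`. The bounds `0 < s < 4` keep `cos
  -- p` and `sin p` nonzero.
  set p : ℝ := Real.arccos (√s / 2)
  have hsq : √s < 2 := by rw [Real.sqrt_lt' two_pos]; linarith
  have hcosp : Real.cos p = √s / 2 :=
    Real.cos_arccos (by linarith [Real.sqrt_nonneg s]) (by linarith)
  have hcos0 : Complex.cos p ≠ 0 := by
    rw [← Complex.ofReal_cos, hcosp]
    exact_mod_cast (by positivity : √s / 2 ≠ 0)
  have hsin0 : Complex.sin p ≠ 0 := by
    rw [← Complex.ofReal_sin, Complex.ofReal_ne_zero, Real.sin_arccos]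
    refine (Real.sqrt_pos.2 ?_).ne'
    have := Real.sq_sqrt hs0
    nlinarith
  have hcs : 4 * Complex.cos p ^ 2 = s := by
    rw [← Complex.ofReal_cos, hcosp]
    norm_cast
    rw [div_pow, Real.sq_sqrt hs0]; ring
  set ζ : ℂ → ℂ := fun x => ψ (4 * Complex.cos x ^ 2) with hζ
  have hcd : ContDiffAt ℂ 1 (fun x : ℂ => 4 * Complex.cos x ^ 2) p := by
    exact (contDiffAt_const.mul (Complex.contDiff_cos.contDiffAt.pow 2))
  have hζd : ContDiffAt ℂ 1 ζ p := by
    refine ContDiffAt.comp (g := ψ) (p : ℂ) ?_ hcd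
    rw [hcs]; exact hψ
  have hζ0 : ζ p = z₀ := by simp only [hζ]; rw [hcs, hψ0]
  have hζr : ∀ᶠ x in 𝓝 (p : ℂ), f (ζ x) = 4 * Complex.cos x ^ 2 := by
    have := hcd.continuousAt.tendsto
    rw [hcs] at this
    exact this.eventually hψr
  set ρ : ℂ → ℂ := fun x => (a * ζ x + b) / (2 * Complex.cos x) with hρ
  have hρd : ContDiffAt ℂ 1 ρ p := by
    refine ((contDiffAt_const.mul hζd).add contDiffAt_const).div
      (contDiffAt_const.mul Complex.contDiff_cos.contDiffAt) (mul_ne_zero two_ne_zero hcos0)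
  have hρ0 : ρ p ≠ 0 := by
    simp only [hρ, hζ0]
    exact div_ne_zero hA (mul_ne_zero two_ne_zero hcos0)
  have hWd (i : ℕ) : ContDiffAt ℂ 1 (fun x => (W i).eval (ζ x)) p := by
    have h1 : ContDiffAt ℂ 1 (fun z => (W i).eval z) (ζ p) := by
      simpa using ((W i).contDiff_aeval (𝕜 := ℂ) 1).contDiffAt
    exact h1.comp (p : ℂ) hζd
  set l : ℂ → ℂ := fun x => ρ x * Complex.exp (x * Complex.I) with hl
  set m : ℂ → ℂ := fun x => ρ x * Complex.exp (-x * Complex.I) with hm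
  have hld : ContDiffAt ℂ 1 l p := hρd.mul ((contDiffAt_id.mul contDiffAt_const).cexp)
  have hmd : ContDiffAt ℂ 1 m p := hρd.mul ((contDiffAt_id.neg.mul contDiffAt_const).cexp)
  have hsum {x : ℂ} (hx : Complex.cos x ≠ 0) : l x + m x = a * ζ x + b := by
    simp only [hl, hm, hρ]
    rw [← mul_add, ← Complex.two_cos]
    field_simp
  have hprod {x : ℂ} (hx : Complex.cos x ≠ 0) (hBx : (c * ζ x ^ 2 + d * ζ x + e : ℂ) ≠ 0)
      (hr : f (ζ x) = 4 * Complex.cos x ^ 2) :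
      l x * m x = -(c * ζ x ^ 2 + d * ζ x + e) := by
    have h1 : l x * m x = ρ x ^ 2 *
        (Complex.exp (x * Complex.I) * Complex.exp (-x * Complex.I)) := by
      simp only [hl, hm]; ring
    rw [h1, ← Complex.exp_add, neg_mul, add_neg_cancel, Complex.exp_zero, mul_one]
    simp only [hf] at hr
    rw [div_eq_iff hBx] at hr
    simp only [hρ]
    rw [div_pow, div_eq_iff (pow_ne_zero 2 (mul_ne_zero two_ne_zero hx))]
    linear_combination -hr
  set u : ℂ → ℂ := fun x => (W 1).eval (ζ x) - l x * (W 0).eval (ζ x) with hu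
  set v : ℂ → ℂ := fun x => (W 1).eval (ζ x) - m x * (W 0).eval (ζ x) with hv
  have hud : ContDiffAt ℂ 1 u p := (hWd 1).sub (hld.mul (hWd 0))
  have hvd : ContDiffAt ℂ 1 v p := (hWd 1).sub (hmd.mul (hWd 0))
  have huv : v p * u p ≠ 0 := by
    have h1 := mul_eq_initForm W (hsum hcos0) (hprod hcos0 (by rw [hζ0]; exact hB) hζr.self_of_nhds)
    rw [hζ0] at h1
    simp only [hu, hv, hζ0]
    rw [h1]; exact hP
  have hu0 := right_ne_zero_of_mul huv
  have hv0 := left_ne_zero_of_mul huv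
  set q : ℂ → ℂ := fun x => u x / v x with hq
  have hqd : ContDiffAt ℂ 1 q p := hud.div hvd hv0
  have hq0 : q p ≠ 0 := div_ne_zero hu0 hv0
  -- A smooth local logarithm of `u / v`, which exists since `P(z₀) ≠ 0`. Zeros of `W_n` near `z₀`
  -- then come from `exp (2 n i x) = u / v`.
  set G : ℂ → ℂ := fun x => Complex.log (q x / q p) + Complex.log (q p) with hG
  have hGd : ContDiffAt ℂ 1 G p := by
    refine ContDiffAt.add (ContDiffAt.comp (g := Complex.log) (p : ℂ) (Complex.contDiffAt_log ?_)
      (hqd.div_const _)) contDiffAt_const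
    rw [div_self hq0]; exact Complex.one_mem_slitPlane
  refine mem_limitsOfZeros_iff.2 fun U hU => ?_
  have hUp : ∀ᶠ x in 𝓝 (p : ℂ), ζ x ∈ U := hζd.continuousAt.eventually (by rw [hζ0]; exact hU)
  have hBp : ∀ᶠ x in 𝓝 (p : ℂ), (c * ζ x ^ 2 + d * ζ x + e : ℂ) ≠ 0 := by
    have h1 : ContinuousAt (fun x => (c * ζ x ^ 2 + d * ζ x + e : ℂ)) p := by
      have := hζd.continuousAt
      fun_prop
    exact h1.eventually_ne (by rw [hζ0]; exact hB)
  have hcosp' := Complex.continuous_cos.continuousAt.eventually_ne hcos0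
  have hsinp' := Complex.continuous_sin.continuousAt.eventually_ne hsin0
  have hgood := eventually_exists_exp_eq hGd (((((((hUp.and hBp).and hcosp').and hsinp').and
    hζr).and (hρd.continuousAt.eventually_ne hρ0)).and (hud.continuousAt.eventually_ne hu0)).and
    (hvd.continuousAt.eventually_ne hv0))
  filter_upwards [hgood] with n hn
  obtain ⟨x, ⟨⟨⟨⟨⟨⟨⟨hxU, hxB⟩, hxc⟩, hxs⟩, hxr⟩, hxρ⟩, hxu⟩, hxv⟩, hx⟩ := hn
  refine ⟨ζ x, hxU, ?_⟩
  have hGx : Complex.exp (G x) = u x / v x := by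
    simp only [hG]
    rw [Complex.exp_add, Complex.exp_log hq0, Complex.exp_log
      (div_ne_zero (div_ne_zero hxu hxv) hq0), div_mul_cancel₀ _ hq0]
  rw [hGx, eq_div_iff hxv] at hx
  have key := sub_mul_of_recurrence (w := fun i => (W i).eval (ζ x)) (hW.eval_recurrence (ζ x))
    (hsum hxc) (hprod hxc hxB hxr) n
  have hlm : l x - m x ≠ 0 := by
    have h1 : l x - m x = 2 * Complex.I * ρ x * Complex.sin x := by
      simp only [hl, hm, Complex.sin]
      linear_combination (-ρ x * (Complex.exp (-x * Complex.I) - Complex.exp (x * Complex.I))) *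
        Complex.I_sq
    rw [h1]
    exact mul_ne_zero (mul_ne_zero (mul_ne_zero two_ne_zero Complex.I_ne_zero) hxρ) hxs
  have hzero : l x ^ n * v x - m x ^ n * u x = 0 := by
    have h2 : Complex.exp (x * Complex.I) ^ n =
        Complex.exp (-x * Complex.I) ^ n * Complex.exp (2 * n * Complex.I * x) := by
      rw [← Complex.exp_nat_mul, ← Complex.exp_nat_mul, ← Complex.exp_add]
      congr 1; ring
    simp only [hl, hm]
    rw [mul_pow, mul_pow, h2]
    linear_combination (ρ x ^ n * Complex.exp (-x * Complex.I) ^ n) * hx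
  change (l x - m x) * (W n).eval (ζ x) = l x ^ n * v x - m x ^ n * u x at key
  rw [hzero] at key
  exact (mul_eq_zero.1 key).resolve_left hlm

/-! ### The equimodular set is perfect and equals `♣`. -/

theorem isClosed_equimodularSet (a b c d e : ℝ) : IsClosed (equimodularSet a b c d e) := by
  have h : equimodularSet a b c d e = Prod.snd '' {p : Set.Icc (0 : ℝ) 4 × ℂ |
      (a * p.2 + b : ℂ) ^ 2 = -((p.1 : ℝ) : ℂ) * (c * p.2 ^ 2 + d * p.2 + e)} := by
    ext z
    constructor
    · rintro ⟨s, hs, h⟩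
      exact ⟨(⟨s, hs⟩, z), h, rfl⟩
    · rintro ⟨⟨s, z⟩, h, rfl⟩
      exact ⟨s, s.2, h⟩
  rw [h]
  refine isClosedMap_snd_of_compactSpace _ (isClosed_eq ?_ ?_) <;> fun_prop

theorem mul_xA_add (a b : ℝ) (ha : a ≠ 0) : (a * (xA a b : ℂ) + b : ℂ) = 0 := by
  rw [xA]; push_cast
  have : (a : ℂ) ≠ 0 := by exact_mod_cast ha
  field_simp
  ring

/-- By the open mapping theorem `f = -A ^ 2 / B` takes, near `w`, values of `[0, 4]` close to but
different from `f w`. If `f` were constant, `A ^ 2 + s B` would vanish identically: at `x_A` this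
forces `s = 0`, and then `A = 0`. -/
theorem accPt_equimodularSet {a b c d e : ℝ} (ha : a ≠ 0) {W : ℕ → ℂ[X]}
    (hW : IsGeneral a b c d e W) {w : ℂ} (hw : w ∈ equimodularSet a b c d e) :
    AccPt w (𝓟 (equimodularSet a b c d e)) := by
  have haC : (a : ℂ) ≠ 0 := by exact_mod_cast ha
  obtain ⟨s, hs, hsw⟩ := hw
  have hB : (c * w ^ 2 + d * w + e : ℂ) ≠ 0 := by
    intro h
    rw [h, mul_zero] at hsw
    exact hW.not_both_zero (pow_eq_zero_iff two_ne_zero |>.1 hsw) h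
  set f : ℂ → ℂ := fun z => -(a * z + b) ^ 2 / (c * z ^ 2 + d * z + e) with hf
  have hfs : f w = s := by
    simp only [hf]
    rw [div_eq_iff hB]
    linear_combination -hsw
  have hBev : ∀ᶠ z in 𝓝 w, (c * z ^ 2 + d * z + e : ℂ) ≠ 0 :=
    ContinuousAt.eventually_ne (by fun_prop) hB
  have hfan : AnalyticAt ℂ f w := by
    have := contDiffAt_charRatio (a := a) (b := b) hB ⊤
    exact this.analyticAt
  rcases hfan.eventually_constant_or_nhds_le_map_nhds with hconst | hmap
  · exfalso
    set R : ℂ[X] := (polyA a b).map (algebraMap ℝ ℂ) ^ 2 +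
      C (s : ℂ) * (polyB c d e).map (algebraMap ℝ ℂ) with hR
    have hReval (z : ℂ) : R.eval z = (a * z + b) ^ 2 + s * (c * z ^ 2 + d * z + e) := by
      simp only [hR, eval_add, eval_mul, eval_pow, eval_C, eval_map_polyA, eval_map_polyB]
    have hR0 : R = 0 := by
      refine eq_zero_of_infinite_isRoot R (infinite_of_mem_nhds w ?_)
      filter_upwards [hconst, hBev] with z h1 h2
      rw [hfs] at h1
      simp only [hf] at h1
      rw [div_eq_iff h2] at h1
      change R.eval z = 0
      rw [hReval]
      linear_combination -h1
    have h0 := hReval (xA a b)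
    have hX := mul_xA_add a b ha
    rw [hR0, hX, eval_zero, zero_pow two_ne_zero, zero_add, eq_comm] at h0
    have hs0 : (s : ℂ) = 0 := (mul_eq_zero.1 h0).resolve_right (hW.not_both_zero hX)
    have h1 := hReval (xA a b + 1)
    rw [hR0, hs0, eval_zero] at h1
    refine haC (pow_eq_zero_iff two_ne_zero |>.1 ?_)
    linear_combination -h1 - (a * xA a b + b + 2 * a) * hX
  · have hreal : ∃ᶠ t in 𝓝 s, t ≠ s ∧ t ∈ Set.Icc (0 : ℝ) 4 :=
      accPt_iff_frequently.1 (isPreconnected_Icc.preperfect_of_nontrivial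
        ⟨0, by norm_num, 4, by norm_num, by norm_num⟩ s hs)
    have hcomplex : ∃ᶠ y : ℂ in 𝓝 (f w), y ≠ s ∧ ∃ t ∈ Set.Icc (0 : ℝ) 4, (t : ℂ) = y := by
      rw [hfs]
      refine (Complex.continuous_ofReal.continuousAt (x := s)).tendsto.frequently
        (hreal.mono fun t ht => ⟨?_, t, ht.2, rfl⟩)
      exact_mod_cast ht.1
    have hz : ∃ᶠ z in 𝓝 w, f z ≠ s ∧ ∃ t ∈ Set.Icc (0 : ℝ) 4, (t : ℂ) = f z :=
      frequently_map.1 (hcomplex.filter_mono hmap)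
    rw [accPt_iff_frequently]
    refine (hz.and_eventually hBev).mono ?_
    rintro z ⟨⟨h1, t, ht, h2⟩, h3⟩
    refine ⟨?_, t, ht, ?_⟩
    · rintro rfl
      exact h1 hfs
    · simp only [hf] at h2
      rw [eq_div_iff h3] at h2
      linear_combination h2

/-- All points of `E` outside the finite zero set of `Q` are limits of zeros; they are dense in the
perfect set `E`, so closedness gives the rest. Limits outside `E` are among the finitely many zeros
of `P`, hence do not accumulate off `E`. -/
theorem nonIsolatedLimits_eq {a b c d e : ℝ} (ha : a ≠ 0) {W : ℕ → ℂ[X]}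
    (hW : IsGeneral a b c d e W) : nonIsolatedLimits W = equimodularSet a b c d e := by
  have haC : (a : ℂ) ≠ 0 := by exact_mod_cast ha
  have hX := mul_xA_add a b ha
  have hBX := hW.not_both_zero hX
  have hPfin : {z | (initForm a b c d e W).IsRoot z}.Finite := by
    by_contra h
    exact hW.not_first_order (eq_zero_of_infinite_isRoot _ h)
  set pA := (polyA a b).map (algebraMap ℝ ℂ) with hpA
  set pB := (polyB c d e).map (algebraMap ℝ ℂ) with hpB
  have hA0 : pA ≠ 0 := by
    intro h
    have h1 := eval_map_polyA a b (xA a b + 1)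
    rw [← hpA, h, eval_zero] at h1
    exact haC (by linear_combination -h1 - hX)
  -- This polynomial and that of `hJ0` are tested at `x_A`, where `A` vanishes and `B` does not.
  have hD0 : pA ^ 2 + 4 * pB ≠ 0 := by
    intro h
    have h1 := congrArg (eval (xA a b : ℂ)) h
    rw [eval_add, eval_pow, eval_mul, hpA, hpB, eval_map_polyA, eval_map_polyB, hX] at h1
    simp at h1
    exact hBX h1
  have hJ0 : C (2 * a : ℂ) * pB - pA * (C (2 * c : ℂ) * X + C (d : ℂ)) ≠ 0 := by
    intro h
    have h1 := congrArg (eval (xA a b : ℂ)) h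
    rw [eval_sub, eval_mul, eval_mul, hpA, hpB, eval_map_polyA, eval_map_polyB, hX] at h1
    simp [ha] at h1
    exact hBX h1
  set Q : ℂ[X] := pA * (pA ^ 2 + 4 * pB) *
    (C (2 * a : ℂ) * pB - pA * (C (2 * c : ℂ) * X + C (d : ℂ))) * initForm a b c d e W with hQ
  have hQ0 : Q ≠ 0 :=
    mul_ne_zero (mul_ne_zero (mul_ne_zero hA0 hD0) hJ0) hW.not_first_order
  have hQfin : {z | Q.IsRoot z}.Finite := by
    by_contra h
    exact hQ0 (eq_zero_of_infinite_isRoot _ h)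
  have hgeneric (z : ℂ) (hz : z ∈ equimodularSet a b c d e) (hzQ : ¬ Q.IsRoot z) :
      z ∈ limitsOfZeros W := by
    have h1 : Q.eval z ≠ 0 := hzQ
    simp only [hQ, eval_mul, eval_sub, eval_add, eval_pow, hpA, hpB, eval_map_polyA,
      eval_map_polyB, eval_C, eval_X, eval_ofNat, mul_ne_zero_iff] at h1
    obtain ⟨⟨⟨h1, h2⟩, h3⟩, h4⟩ := h1
    exact mem_limitsOfZeros_of_generic hW hz h1 h2 h3 h4
  have hsub : equimodularSet a b c d e ⊆ limitsOfZeros W := by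
    intro w hw
    rw [← (isClosed_limitsOfZeros W).closure_eq, mem_closure_iff_frequently]
    have h1 := accPt_iff_frequently.1 (accPt_equimodularSet ha hW hw)
    have h2 : ∀ᶠ z in 𝓝 w, z ∉ {z | Q.IsRoot z} \ {w} :=
      (hQfin.subset Set.sdiff_subset).isClosed.isOpen_compl.mem_nhds (by simp)
    refine (h1.and_eventually h2).mono ?_
    rintro z ⟨⟨hzw, hz⟩, hzQ⟩
    exact hgeneric z hz fun h => hzQ ⟨h, hzw⟩
  ext w
  constructor
  · rintro ⟨-, hacc⟩
    by_contra hwE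
    have h1 := (isClosed_equimodularSet a b c d e).isOpen_compl.mem_nhds hwE
    have h2 : ∀ᶠ z in 𝓝 w, z ∉ {z | (initForm a b c d e W).IsRoot z} \ {w} :=
      (hPfin.subset Set.sdiff_subset).isClosed.isOpen_compl.mem_nhds (by simp)
    obtain ⟨z, ⟨hzw, hz⟩, hzE, hzP⟩ := ((accPt_iff_frequently.1 hacc).and_eventually
      ((show ∀ᶠ z in 𝓝 w, z ∉ equimodularSet a b c d e from h1).and h2)).exists
    exact hzP ⟨eval_initForm_eq_zero hW hz hzE, hzw⟩
  · intro hw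
    exact ⟨hsub hw, (accPt_equimodularSet ha hW hw).mono (principal_mono.2 hsub)⟩

/-! ### The equimodular set in real coordinates centred at `x_A`; the case `Δ_Δ ≥ 0`. -/

theorem BxA_eq (a b c d e : ℝ) : BxA a b c d e = c * xA a b ^ 2 + d * xA a b + e := by
  simp [BxA, polyB]

theorem BxA'_eq (a b c d e : ℝ) : BxA' a b c d e = 2 * c * xA a b + d := by
  simp [BxA', polyB]
  ring

theorem mul_xA {a : ℝ} (b : ℝ) (ha : a ≠ 0) : a * xA a b = -b := by
  rw [xA, mul_div_cancel₀ _ ha]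

theorem discDelta_eq (a b c d e : ℝ) :
    discDelta a b c d e = 16 * (BxA' a b c d e ^ 2 - BxA a b c d e * (a ^ 2 + 4 * c)) := by
  rw [discDelta, BxA'_eq, BxA_eq]
  ring

/-- The equation of `C₀`. -/
def onC0 (a b c d e : ℝ) (z : ℂ) : Prop :=
  BxA' a b c d e * ((z.re - xA a b) ^ 2 + z.im ^ 2) + 2 * BxA a b c d e * (z.re - xA a b) = 0

/-- Write `z - x_A = x + i y` and `N = x ^ 2 + y ^ 2`. For `y ≠ 0`, real and imaginary parts combine
to `a ^ 2 N = s (B - c N)` and `2 a ^ 2 x = -s (2 c x + B')`. Eliminating `s` gives `C₀`, and `s ≤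
4` gives the inequality. For `y = 0`, the point `x = 0` comes from `s = 0`, and otherwise `s ≤ 4` is
`Δ ≤ 0`. -/
theorem mem_equimodularSet_iff {a b c d e : ℝ} (ha : a ≠ 0) (z : ℂ) :
    z ∈ equimodularSet a b c d e ↔
      (z.im = 0 ∧ (z.re = xA a b ∨ (a ^ 2 + 4 * c) * (z.re - xA a b) ^ 2 +
        4 * BxA' a b c d e * (z.re - xA a b) + 4 * BxA a b c d e ≤ 0)) ∨
      (z.im ≠ 0 ∧ onC0 a b c d e z ∧
        (a ^ 2 + 4 * c) * ((z.re - xA a b) ^ 2 + z.im ^ 2) ≤ 4 * BxA a b c d e) := by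
  have hX := mul_xA b ha
  have ha2 : 0 < a ^ 2 := by positivity
  rw [← sub_eq_zero (a := z.re)]
  have heq (s : ℝ) : ((a * z + b : ℂ) ^ 2 = -s * (c * z ^ 2 + d * z + e)) ↔
      a ^ 2 * ((z.re - xA a b) ^ 2 - z.im ^ 2) = -s * (c * ((z.re - xA a b) ^ 2 - z.im ^ 2) +
        BxA' a b c d e * (z.re - xA a b) + BxA a b c d e) ∧
      z.im * (2 * a ^ 2 * (z.re - xA a b)) =
        z.im * (-s * (2 * c * (z.re - xA a b) + BxA' a b c d e)) := by
    rw [BxA_eq, BxA'_eq, Complex.ext_iff]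
    obtain ⟨x, y⟩ := z
    have hb : b = -(a * xA a b) := by linarith
    simp only [pow_two, Complex.mul_re, Complex.mul_im, Complex.add_re, Complex.add_im,
      Complex.ofReal_re, Complex.ofReal_im, Complex.neg_re, Complex.neg_im]
    generalize xA a b = q at *
    subst hb
    refine and_congr ?_ ?_
    · constructor <;> intro h <;> linear_combination h
    · constructor <;> intro h <;> linear_combination h
  have hmem : z ∈ equimodularSet a b c d e ↔ ∃ s ∈ Set.Icc (0 : ℝ) 4,
      (a * z + b : ℂ) ^ 2 = -s * (c * z ^ 2 + d * z + e) := Iff.rfl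
  simp only [hmem, heq, onC0]
  generalize z.re - xA a b = x
  generalize z.im = y
  generalize BxA a b c d e = B
  generalize BxA' a b c d e = B'
  constructor
  · rintro ⟨s, ⟨hs0, hs4⟩, hre, him⟩
    by_cases hy : y = 0
    · refine Or.inl ⟨hy, ?_⟩
      by_cases hx : x = 0
      · exact Or.inl hx
      · right
        rw [hy] at hre
        have hx2 : 0 < a ^ 2 * x ^ 2 := by positivity
        have h1 : a ^ 2 * x ^ 2 = s * -(c * x ^ 2 + B' * x + B) := by linarith
        have h2 : 0 < -(c * x ^ 2 + B' * x + B) := by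
          by_contra h
          rw [h1] at hx2
          nlinarith
        nlinarith
    · refine Or.inr ⟨hy, ?_⟩
      replace him := mul_left_cancel₀ hy him
      have hN : 0 < x ^ 2 + y ^ 2 := by positivity
      have h1 : a ^ 2 * (x ^ 2 + y ^ 2) = s * (B - c * (x ^ 2 + y ^ 2)) := by
        linear_combination x * him - hre
      have hN' : 0 < a ^ 2 * (x ^ 2 + y ^ 2) := by positivity
      have hs : s ≠ 0 := by
        rintro rfl
        linarith
      have h2 : 0 < B - c * (x ^ 2 + y ^ 2) := by
        by_contra h
        rw [h1] at hN'
        nlinarith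
      refine ⟨?_, by nlinarith⟩
      refine (mul_eq_zero.1 (?_ : s * _ = 0)).resolve_left hs
      linear_combination (x ^ 2 + y ^ 2) * him - 2 * x * h1
  · rintro (⟨rfl, rfl | h⟩ | ⟨hy, hC, hD⟩)
    · exact ⟨0, ⟨le_rfl, by norm_num⟩, by ring, by ring⟩
    · by_cases hx : x = 0
      · subst hx
        exact ⟨0, ⟨le_rfl, by norm_num⟩, by ring, by ring⟩
      have hx2 : 0 < a ^ 2 * x ^ 2 := by positivity
      have hq : 0 < -(c * x ^ 2 + B' * x + B) := by linarith
      refine ⟨a ^ 2 * x ^ 2 / -(c * x ^ 2 + B' * x + B), ⟨by positivity, ?_⟩, ?_, by ring⟩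
      · rw [div_le_iff₀ hq]; linarith
      · have := hq.ne'
        generalize hq' : -(c * x ^ 2 + B' * x + B) = q at *
        have : c * (x ^ 2 - 0 ^ 2) + B' * x + B = -q := by linarith
        rw [this]
        field_simp
        ring
    · have hN : 0 < a ^ 2 * (x ^ 2 + y ^ 2) := by positivity
      have hq : 0 < B - c * (x ^ 2 + y ^ 2) := by linarith
      refine ⟨a ^ 2 * (x ^ 2 + y ^ 2) / (B - c * (x ^ 2 + y ^ 2)), ⟨by positivity, ?_⟩, ?_, ?_⟩
      · rw [div_le_iff₀ hq]; linarith
      · rw [neg_mul, div_mul_eq_mul_div, ← neg_div, eq_div_iff hq.ne']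
        linear_combination a ^ 2 * x * hC
      · congr 1
        rw [neg_mul, div_mul_eq_mul_div, ← neg_div, eq_div_iff hq.ne']
        linear_combination a ^ 2 * hC

theorem mem_C0_iff {a b c d e : ℝ} (hB : BxA a b c d e ≠ 0) (z : ℂ) :
    z ∈ C0 a b c d e ↔ onC0 a b c d e z := by
  unfold C0 onC0
  split_ifs with h
  · rw [Set.mem_ofPred_eq, ← sq_eq_sq₀ (norm_nonneg _) (abs_nonneg _), sq_abs,
      ← Complex.normSq_eq_norm_sq,
      Complex.normSq_apply]
    simp only [Complex.add_re, Complex.sub_re, Complex.ofReal_re, Complex.add_im, Complex.sub_im,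
      Complex.ofReal_im]
    have hr : BxA' a b c d e * radius a b c d e = BxA a b c d e := by
      rw [radius, mul_div_cancel₀ _ h]
    rw [← hr]
    constructor
    · intro h1
      linear_combination BxA' a b c d e * h1
    · intro h1
      refine mul_left_cancel₀ h ?_
      linear_combination h1
  · rw [not_not] at h
    rw [h, Set.mem_ofPred_eq, ← sub_eq_zero]
    simp [hB]

theorem mem_JDelta_iff {a b c d e : ℝ} (ha : a ≠ 0) (z : ℂ) :
    z ∈ JDelta a b c d e ↔ z.im = 0 ∧ (a ^ 2 + 4 * c) * (z.re - xA a b) ^ 2 +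
        4 * BxA' a b c d e * (z.re - xA a b) + 4 * BxA a b c d e ≤ 0 := by
  have hX := mul_xA b ha
  have heval (x : ℝ) : (polyDelta a b c d e).eval x = (a ^ 2 + 4 * c) * (x - xA a b) ^ 2 +
        4 * BxA' a b c d e * (x - xA a b) + 4 * BxA a b c d e := by
    rw [BxA_eq, BxA'_eq]
    simp [polyDelta, polyA, polyB]
    have hb : b = -(a * xA a b) := by linarith
    generalize xA a b = q at *
    subst hb
    ring
  constructor
  · rintro ⟨x, hx, rfl⟩
    exact ⟨Complex.ofReal_im x, by rw [← heval]; exact hx⟩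
  · rintro ⟨h1, h2⟩
    refine ⟨z.re, by rw [Set.mem_ofPred_eq, heval]; exact h2, ?_⟩
    exact Complex.ext rfl h1.symm

/-- With `D = a ^ 2 + 4 c`, the hypothesis on `Δ_Δ` reads `B D ≤ B' ^ 2`. At a nonreal point of
`C₀`, squaring `B' N = -2 B x` with `x ^ 2 < N` gives `B D N ≤ B' ^ 2 N < 4 B ^ 2`; dividing by `B <
0` contradicts `D N ≤ 4 B`. -/
theorem equimodularSet_eq_JDelta {a b c d e : ℝ} (ha : a ≠ 0) (hd : 0 ≤ discDelta a b c d e)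
    (hB : BxA a b c d e < 0) : equimodularSet a b c d e = JDelta a b c d e := by
  ext z
  rw [mem_equimodularSet_iff ha, mem_JDelta_iff ha]
  rw [discDelta_eq] at hd
  unfold onC0
  rw [← sub_eq_zero (a := z.re)]
  generalize z.re - xA a b = x
  generalize z.im = y
  generalize BxA a b c d e = B at *
  generalize BxA' a b c d e = B' at *
  generalize a ^ 2 + 4 * c = D at *
  constructor
  · rintro (⟨rfl, rfl | h⟩ | ⟨hy, hC, hD⟩)
    · exact ⟨rfl, by nlinarith⟩
    · exact ⟨rfl, h⟩
    · exfalso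
      have hy2 : 0 < y ^ 2 := by positivity
      have hN : 0 < x ^ 2 + y ^ 2 := by positivity
      have h1 : (B' * (x ^ 2 + y ^ 2)) ^ 2 = 4 * B ^ 2 * x ^ 2 := by
        rw [show B' * (x ^ 2 + y ^ 2) = -(2 * B * x) by linarith]; ring
      have h2 : (x ^ 2 + y ^ 2) * (B' ^ 2 * (x ^ 2 + y ^ 2)) < (x ^ 2 + y ^ 2) * (4 * B ^ 2) := by
        have : 0 < B ^ 2 * y ^ 2 := by have := hB.ne; positivity
        nlinarith
      have h3 := lt_of_mul_lt_mul_left h2 hN.le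
      have h4 : B * D * (x ^ 2 + y ^ 2) ≤ B' ^ 2 * (x ^ 2 + y ^ 2) := by
        gcongr; linarith
      nlinarith
  · rintro ⟨h1, h2⟩
    exact Or.inl ⟨h1, Or.inr h2⟩

/-- The same estimate divided by `B > 0` shows that `D N ≤ 4 B` holds at every point of `C₀`, so
nothing is cut off. -/
theorem equimodularSet_eq_JDelta_union {a b c d e : ℝ} (ha : a ≠ 0)
    (hd : 0 ≤ discDelta a b c d e) (hB : 0 < BxA a b c d e) :
    equimodularSet a b c d e = JDelta a b c d e ∪ C0 a b c d e := by
  ext z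
  rw [Set.mem_union, mem_equimodularSet_iff ha, mem_JDelta_iff ha, mem_C0_iff hB.ne']
  rw [discDelta_eq] at hd
  unfold onC0
  rw [← sub_eq_zero (a := z.re)]
  generalize z.re - xA a b = x
  generalize z.im = y
  generalize BxA a b c d e = B at *
  generalize BxA' a b c d e = B' at *
  generalize a ^ 2 + 4 * c = D at *
  constructor
  · rintro (⟨rfl, rfl | h⟩ | ⟨hy, hC, hD⟩)
    · right; ring
    · exact Or.inl ⟨rfl, h⟩
    · exact Or.inr hC
  · rintro (⟨h1, h2⟩ | hC)
    · exact Or.inl ⟨h1, Or.inr h2⟩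
    have hN : 0 ≤ x ^ 2 + y ^ 2 := by positivity
    have hle : x ≠ 0 ∨ y ≠ 0 → D * (x ^ 2 + y ^ 2) ≤ 4 * B := by
      intro hxy
      have hN' : 0 < x ^ 2 + y ^ 2 := by rcases hxy with h | h <;> positivity
      have h1 : (B' * (x ^ 2 + y ^ 2)) ^ 2 = 4 * B ^ 2 * x ^ 2 := by
        rw [show B' * (x ^ 2 + y ^ 2) = -(2 * B * x) by linarith]; ring
      have h2 : (x ^ 2 + y ^ 2) * (B' ^ 2 * (x ^ 2 + y ^ 2)) ≤ (x ^ 2 + y ^ 2) * (4 * B ^ 2) := by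
        have : 0 ≤ B ^ 2 * y ^ 2 := by positivity
        nlinarith
      have h3 := le_of_mul_le_mul_left h2 hN'
      have h4 : B * D * (x ^ 2 + y ^ 2) ≤ B' ^ 2 * (x ^ 2 + y ^ 2) := by
        gcongr; linarith
      refine le_of_mul_le_mul_left (a := B) ?_ hB
      linarith
    by_cases hy : y = 0
    · subst hy
      refine Or.inl ⟨rfl, ?_⟩
      by_cases hx : x = 0
      · exact Or.inl hx
      · right
        have h1 := hle (Or.inl hx)
        have h2 : B' * x = -(2 * B) := by
          refine mul_left_cancel₀ hx ?_
          linear_combination hC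
        linarith
    · exact Or.inr ⟨hy, hC, hle (Or.inr hy)⟩

/-! ### Segments, rays and arcs with endpoints `h ± i k`. -/

theorem lineMap_vertical {h k : ℝ} (hk : 0 < k) {z : ℂ} (hz : z.re = h) :
    AffineMap.lineMap (⟨h, -k⟩ : ℂ) (⟨h, k⟩ : ℂ) ((z.im + k) / (2 * k)) = z := by
  have ht : (z.im + k) / (2 * k) * (2 * k) = z.im + k := div_mul_cancel₀ _ (by positivity)
  generalize (z.im + k) / (2 * k) = t at *
  apply Complex.ext <;> simp [AffineMap.lineMap_apply, hz]
  linarith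

theorem mem_line_iff {h k : ℝ} (hk : 0 < k) (z : ℂ) :
    z ∈ line[ℝ, (⟨h, -k⟩ : ℂ), (⟨h, k⟩ : ℂ)] ↔ z.re = h := by
  rw [mem_affineSpan_pair_iff_exists_lineMap_eq]
  constructor
  · rintro ⟨t, rfl⟩
    simp [AffineMap.lineMap_apply]
  · intro hz
    exact ⟨(z.im + k) / (2 * k), lineMap_vertical hk hz⟩

theorem mem_segment_vertical_iff {h k : ℝ} (hk : 0 < k) (z : ℂ) :
    z ∈ segment ℝ (⟨h, -k⟩ : ℂ) (⟨h, k⟩ : ℂ) ↔ z.re = h ∧ z.im ^ 2 ≤ k ^ 2 := by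
  rw [sq_le_sq, abs_of_pos hk, abs_le, segment_eq_image_lineMap]
  constructor
  · rintro ⟨t, ⟨h0, h1⟩, rfl⟩
    simp [AffineMap.lineMap_apply]
    constructor <;> nlinarith
  · rintro ⟨hz, h1, h2⟩
    refine ⟨(z.im + k) / (2 * k), ⟨by apply div_nonneg <;> linarith, ?_⟩,
      lineMap_vertical hk hz⟩
    rw [div_le_one (by positivity)]; linarith

theorem mem_arcThroughInfinity_iff {h k : ℝ} (hk : 0 < k) (z : ℂ) :
    z ∈ arcThroughInfinity ⟨h, -k⟩ ⟨h, k⟩ ↔ z.re = h ∧ k ^ 2 ≤ z.im ^ 2 := by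
  rw [arcThroughInfinity, Set.mem_ofPred_eq, mem_line_iff hk, Sbtw, ← mem_segment_iff_wbtw,
    mem_segment_vertical_iff hk]
  refine and_congr_right fun hz => ?_
  constructor
  · intro h1
    by_contra! h2
    refine h1 ⟨⟨hz, h2.le⟩, ?_, ?_⟩ <;> rintro rfl <;> simp at h2
  · rintro h1 ⟨⟨-, h2⟩, h3, h4⟩
    rcases sq_eq_sq_iff_eq_or_eq_neg.1 (le_antisymm h2 h1) with h5 | h5
    · exact h4 (Complex.ext hz h5)
    · exact h3 (Complex.ext hz h5)

theorem wSameSide_vertical_iff {h k : ℝ} (hk : 0 < k) (w z : ℂ) :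
    line[ℝ, (⟨h, -k⟩ : ℂ), (⟨h, k⟩ : ℂ)].WSameSide w z ↔ 0 ≤ (z.re - h) * (w.re - h) := by
  simp only [AffineSubspace.WSameSide, mem_line_iff hk, vsub_eq_sub]
  constructor
  · rintro ⟨p, hp, q, hq, h1⟩
    rw [← hp]
    nth_rw 1 [hp, ← hq]
    rw [← Complex.sub_re, ← Complex.sub_re]
    rcases h1 with h1 | h1 | ⟨r, s, hr, hs, h1⟩
    · rw [h1]; simp
    · rw [h1]; simp
    · have h2 := congrArg Complex.re h1
      rw [Complex.smul_re, Complex.smul_re, smul_eq_mul, smul_eq_mul] at h2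
      generalize (w - p).re = x at *
      generalize (z - q).re = y at *
      have h3 : r * (y * x) = s * y ^ 2 := by linear_combination y * h2
      refine le_of_mul_le_mul_left (a := r) ?_ hr
      rw [h3, mul_zero]
      positivity
  · intro h1
    refine ⟨⟨h, w.im⟩, rfl, ⟨h, z.im⟩, rfl, ?_⟩
    have h2 : w - ⟨h, w.im⟩ = ((w.re - h : ℝ) : ℂ) := by apply Complex.ext <;> simp
    have h3 : z - ⟨h, z.im⟩ = ((z.re - h : ℝ) : ℂ) := by apply Complex.ext <;> simp
    rw [h2, h3]
    rcases eq_or_ne (w.re - h) 0 with h4 | h4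
    · rw [h4, Complex.ofReal_zero]; exact SameRay.zero_left _
    · have h5 : ((z.re - h : ℝ) : ℂ) = ((z.re - h) / (w.re - h)) • ((w.re - h : ℝ) : ℂ) := by
        rw [Complex.real_smul, ← Complex.ofReal_mul, div_mul_cancel₀ _ h4]
      rw [h5]
      apply SameRay.sameRay_nonneg_smul_right
      rw [← mul_div_mul_right _ _ h4]
      exact div_nonneg h1 (mul_self_nonneg _)

theorem collinear_vertical_iff {h k q : ℝ} (hk : 0 < k) :
    Collinear ℝ {(⟨h, -k⟩ : ℂ), (q : ℂ), (⟨h, k⟩ : ℂ)} ↔ q = h := by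
  rw [collinear_iff_of_mem (p₀ := (⟨h, -k⟩ : ℂ)) (by simp)]
  constructor
  · rintro ⟨v, hv⟩
    obtain ⟨r, hr⟩ := hv q (by simp)
    obtain ⟨s, hs⟩ := hv ⟨h, k⟩ (by simp)
    have h1 := congrArg Complex.re hs
    have h2 := congrArg Complex.im hs
    have h3 := congrArg Complex.re hr
    simp at h1 h2 h3
    rcases h1 with rfl | h1
    · linarith
    · rw [h1] at h3; linarith
  · rintro rfl
    refine ⟨Complex.I, ?_⟩
    simp only [Set.mem_insert_iff, Set.mem_singleton_iff, forall_eq_or_imp, forall_eq]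
    refine ⟨⟨0, by simp⟩, ⟨k, ?_⟩, ⟨2 * k, ?_⟩⟩ <;> apply Complex.ext <;> simp
    ring

/-- The centre `o` is real by symmetry, and `2 (o - q) (h - q) = (h - q) ^ 2 + k ^ 2`. The point `z`
satisfies `2 (o - q) (Re z - q) = |z - q| ^ 2`; eliminating `o` gives the equation. -/
theorem cospherical_vertical_iff {h k q : ℝ} (hk : 0 < k) (hq : q ≠ h) (z : ℂ) :
    EuclideanGeometry.Cospherical {(⟨h, -k⟩ : ℂ), (q : ℂ), (⟨h, k⟩ : ℂ), z} ↔
      ((z.re - q) ^ 2 + z.im ^ 2) * (h - q) = ((h - q) ^ 2 + k ^ 2) * (z.re - q) := by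
  have hhq : h - q ≠ 0 := sub_ne_zero.2 hq.symm
  simp only [EuclideanGeometry.Cospherical, Set.mem_insert_iff, Set.mem_singleton_iff,
    forall_eq_or_imp, forall_eq, Complex.dist_eq_re_im, Complex.ofReal_re, Complex.ofReal_im]
  constructor
  · rintro ⟨o, R, h1, h2, h3, h4⟩
    rw [← h1, Real.sqrt_inj (by positivity) (by positivity)] at h2 h3 h4
    have h5 : o.im = 0 := by
      refine (mul_eq_zero.1 (?_ : k * o.im = 0)).resolve_left hk.ne'
      linarith
    rw [h5] at h2 h4
    have h6 : 2 * (o.re - q) * (h - q) = (h - q) ^ 2 + k ^ 2 := by linarith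
    have h7 : 2 * (o.re - q) * (z.re - q) = (z.re - q) ^ 2 + z.im ^ 2 := by linarith
    rw [← h6, ← h7]; ring
  · intro h1
    set o : ℝ := q + ((h - q) ^ 2 + k ^ 2) / (2 * (h - q)) with ho
    have h6 : 2 * (o - q) * (h - q) = (h - q) ^ 2 + k ^ 2 := by
      rw [ho]; field_simp; ring
    have h7 : 2 * (o - q) * (z.re - q) = (z.re - q) ^ 2 + z.im ^ 2 := by
      refine mul_right_cancel₀ hhq ?_
      rw [h1, ← h6]; ring
    refine ⟨o, √((q - o) ^ 2), ?_, ?_, ?_, ?_⟩ <;> congr 1 <;>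
      simp only [Complex.ofReal_re, Complex.ofReal_im] <;> linarith

theorem mem_arc_iff {h k q : ℝ} (hk : 0 < k) (hq : q ≠ h) (z : ℂ) :
    z ∈ arc ⟨h, -k⟩ q ⟨h, k⟩ ↔
      ((z.re - q) ^ 2 + z.im ^ 2) * (h - q) = ((h - q) ^ 2 + k ^ 2) * (z.re - q) ∧
      0 ≤ (z.re - h) * (q - h) := by
  rw [arc, if_neg (mt (collinear_vertical_iff hk).1 hq), Set.mem_ofPred_eq,
    cospherical_vertical_iff hk hq, wSameSide_vertical_iff hk, Complex.ofReal_re]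

theorem arc_eq_segment {h k : ℝ} (hk : 0 < k) :
    arc ⟨h, -k⟩ h ⟨h, k⟩ = segment ℝ ⟨h, -k⟩ ⟨h, k⟩ := by
  rw [arc, if_pos ((collinear_vertical_iff hk).2 rfl)]

/-! ### The conjugate zeros of `Δ` when `Δ_Δ < 0`. -/

/-- The real part of `x_Δ^±` when these are not real. -/
def centre (a b c d : ℝ) : ℝ := (-a * b - 2 * d) / (a ^ 2 + 4 * c)

/-- The imaginary part of `x_Δ⁺` when it is not real. -/
def halfHeight (a b c d e : ℝ) : ℝ := √(-discDelta a b c d e) / (2 * |a ^ 2 + 4 * c|)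

theorem discDelta_cpow {a b c d e : ℝ} (hd : discDelta a b c d e < 0) :
    (discDelta a b c d e : ℂ) ^ (1 / 2 : ℂ) = √(-discDelta a b c d e) * Complex.I := by
  rw [Complex.ofReal_cpow_of_nonpos hd.le, ← Complex.ofReal_neg, Real.sqrt_eq_rpow,
    Complex.ofReal_cpow (by linarith)]
  congr 1
  · push_cast; rfl
  · rw [mul_one_div, mul_div_right_comm, Complex.exp_pi_div_two_mul_I]

theorem ne_zero_of_discDelta_neg {a b c d e : ℝ} (hd : discDelta a b c d e < 0) :
    a ^ 2 + 4 * c ≠ 0 := by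
  intro h
  rw [discDelta_eq, h] at hd
  nlinarith [sq_nonneg (BxA' a b c d e)]

theorem halfHeight_pos {a b c d e : ℝ} (hd : discDelta a b c d e < 0) :
    0 < halfHeight a b c d e := by
  have := ne_zero_of_discDelta_neg hd
  have : 0 < √(-discDelta a b c d e) := Real.sqrt_pos.2 (by linarith)
  unfold halfHeight
  positivity

theorem xDeltaPlus_eq {a b c d e : ℝ} (hd : discDelta a b c d e < 0) :
    xDeltaPlus a b c d e = ⟨centre a b c d, halfHeight a b c d e⟩ := by
  rw [xDeltaPlus, discDelta_cpow hd, mul_div_right_comm, ← Complex.ofReal_div,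
    Complex.mk_eq_add_mul_I]
  rfl

theorem xDeltaMinus_eq {a b c d e : ℝ} (hd : discDelta a b c d e < 0) :
    xDeltaMinus a b c d e = ⟨centre a b c d, -halfHeight a b c d e⟩ := by
  rw [xDeltaMinus, discDelta_cpow hd, mul_div_right_comm, ← Complex.ofReal_div,
    Complex.mk_eq_add_mul_I, Complex.ofReal_neg (halfHeight a b c d e),
    neg_mul (halfHeight a b c d e : ℂ),
    ← sub_eq_add_neg]
  rfl

theorem halfHeight_sq {a b c d e : ℝ} (hd : discDelta a b c d e < 0) :
    (a ^ 2 + 4 * c) ^ 2 * halfHeight a b c d e ^ 2 = -discDelta a b c d e / 4 := by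
  have h0 := ne_zero_of_discDelta_neg hd
  rw [halfHeight, div_pow, Real.sq_sqrt (by linarith), mul_pow, sq_abs]
  field_simp
  ring

/-- Together with `centre_sq_add`, these are Vieta's formulas for `Δ` as a polynomial in `z - x_A`.
-/
theorem centre_sub {a : ℝ} (b c d e : ℝ) (ha : a ≠ 0) (h0 : a ^ 2 + 4 * c ≠ 0) :
    (a ^ 2 + 4 * c) * (centre a b c d - xA a b) = -2 * BxA' a b c d e := by
  have hX := mul_xA b ha
  rw [BxA'_eq, mul_sub, centre, mul_div_cancel₀ _ h0]
  linear_combination -a * hX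

theorem centre_sq_add {a b c d e : ℝ} (ha : a ≠ 0) (hd : discDelta a b c d e < 0) :
    (a ^ 2 + 4 * c) * ((centre a b c d - xA a b) ^ 2 + halfHeight a b c d e ^ 2) =
      4 * BxA a b c d e := by
  have h0 := ne_zero_of_discDelta_neg hd
  have h1 := halfHeight_sq hd
  have h2 := centre_sub b c d e ha h0
  rw [discDelta_eq] at h1
  refine mul_left_cancel₀ h0 ?_
  linear_combination h1 + ((a ^ 2 + 4 * c) * (centre a b c d - xA a b) - 2 * BxA' a b c d e) * h2

theorem zeros_polyDelta {a b c d e : ℝ} (ha : a ≠ 0) (hd : discDelta a b c d e < 0) :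
    {z : ℂ | aeval z (polyDelta a b c d e) = 0} =
      {xDeltaMinus a b c d e, xDeltaPlus a b c d e} := by
  have h0 := ne_zero_of_discDelta_neg hd
  have h0C : ((a ^ 2 + 4 * c : ℝ) : ℂ) ≠ 0 := Complex.ofReal_ne_zero.2 h0
  have h1 := centre_sub b c d e ha h0
  have h2 := centre_sq_add ha hd
  have hX := mul_xA b ha
  rw [BxA'_eq] at h1
  rw [BxA_eq] at h2
  ext z
  rw [Set.mem_ofPred_eq, Set.mem_insert_iff, Set.mem_singleton_iff, xDeltaPlus_eq hd,
    xDeltaMinus_eq hd, Complex.mk_eq_add_mul_I, Complex.mk_eq_add_mul_I, ← sub_eq_zero (a := z),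
    ← sub_eq_zero (a := z) (b := _ + ((halfHeight a b c d e : ℝ) : ℂ) * Complex.I), ← mul_eq_zero]
  generalize centre a b c d = h at *
  generalize halfHeight a b c d e = k at *
  have hb : b = -(a * xA a b) := by linarith
  generalize xA a b = q at *
  subst hb
  have h1' := congrArg Complex.ofReal h1
  have h2' := congrArg Complex.ofReal h2
  push_cast at h1' h2'
  have : aeval z (polyDelta a (-(a * q)) c d e) = ((a ^ 2 + 4 * c : ℝ) : ℂ) *
      ((z - (h + ((-k : ℝ) : ℂ) * Complex.I)) * (z - (h + k * Complex.I))) := by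
    simp only [polyDelta, polyA, polyB, map_add, map_mul, map_pow, aeval_X, aeval_C, map_ofNat,
      Complex.coe_algebraMap]
    push_cast
    linear_combination 2 * (z - q) * h1' - h2' + (a ^ 2 + 4 * c) * k ^ 2 * Complex.I_sq
  rw [this, mul_eq_zero_iff_left h0C]

/-! ### The arcs of `C₀` when `Δ_Δ < 0`. -/

/-- On the circle through `0` and `h ± i k`, being no farther from `0` than the endpoints is being
on the side of the chord containing `0`. -/
theorem le_iff_of_mul_eq_mul {h x M N : ℝ} (hh : h ≠ 0) (hM : 0 < M) (hN : N * h = M * x) :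
    N ≤ M ↔ 0 ≤ (x - h) * -h := by
  have hh2 : 0 < h ^ 2 := by positivity
  rw [← sub_nonneg, ← mul_nonneg_iff_of_pos_left hh2,
    show h ^ 2 * (M - N) = M * ((x - h) * -h) by linear_combination -h * hN,
    mul_nonneg_iff_of_pos_left hM]

/-- The hypothesis places `h` strictly between `0` and `-2 r`, so `r` and `-2 r - h` have opposite
signs. -/
theorem mul_nonpos_iff_of_sq_add_neg {h r x : ℝ} (hhr : h * (h + 2 * r) < 0) :
    (x - h) * r ≤ 0 ↔ 0 ≤ (x - h) * (-(2 * r) - h) := by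
  have hh : h ≠ 0 := by rintro rfl; simp at hhr
  have hh2 : 0 < h ^ 2 := by positivity
  have hrh : r * h < 0 := by nlinarith
  have hr : r ≠ 0 := by rintro rfl; simp at hrh
  have hr2 : 0 < r ^ 2 := by positivity
  have ht : 0 < r * (h + 2 * r) := by
    refine pos_of_mul_pos_right (a := h ^ 2) ?_ hh2.le
    nlinarith
  rw [← neg_nonneg, ← mul_nonneg_iff_of_pos_left ht,
    show r * (h + 2 * r) * -((x - h) * r) = r ^ 2 * ((x - h) * (-(2 * r) - h)) by ring,
    mul_nonneg_iff_of_pos_left hr2]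

/-- Here `B > 0`, and completing the square shows `Δ > 0` on `ℝ`. By Vieta `4 B / D` is the squared
distance from `x_A` to `x_Δ^±`, so the inequality selects the part of `C₀` no farther from `x_A`
than its endpoints. -/
theorem equimodularSet_eq_arc {a b c d e : ℝ} (ha : a ≠ 0) (hd : discDelta a b c d e < 0)
    (hD : 0 < a ^ 2 + 4 * c) :
    equimodularSet a b c d e =
      arc (xDeltaMinus a b c d e) (xA a b : ℂ) (xDeltaPlus a b c d e) := by
  have h1 := centre_sub b c d e ha hD.ne'
  have h2 := centre_sq_add ha hd
  have hk := halfHeight_pos hd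
  rw [xDeltaPlus_eq hd, xDeltaMinus_eq hd]
  rw [discDelta_eq] at hd
  have hB : 0 < BxA a b c d e := by
    by_contra! h
    nlinarith [sq_nonneg (BxA' a b c d e)]
  have hE (z : ℂ) : z ∈ equimodularSet a b c d e ↔ onC0 a b c d e z ∧
      (a ^ 2 + 4 * c) * ((z.re - xA a b) ^ 2 + z.im ^ 2) ≤ 4 * BxA a b c d e := by
    rw [mem_equimodularSet_iff ha, ← sub_eq_zero (a := z.re)]
    unfold onC0
    generalize z.re - xA a b = x
    generalize z.im = y
    generalize BxA a b c d e = B at *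
    generalize BxA' a b c d e = B' at *
    generalize a ^ 2 + 4 * c = D at *
    have hneg (x : ℝ) : 0 < D * x ^ 2 + 4 * B' * x + 4 * B := by
      refine pos_of_mul_pos_right (a := D) ?_ hD.le
      nlinarith [sq_nonneg (D * x + 2 * B')]
    constructor
    · rintro (⟨rfl, rfl | h⟩ | ⟨hy, hC, h⟩)
      · exact ⟨by ring, by nlinarith⟩
      · exact absurd h (hneg x).not_ge
      · exact ⟨hC, h⟩
    · rintro ⟨hC, h⟩
      by_cases hy : y = 0
      · subst hy
        refine Or.inl ⟨rfl, ?_⟩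
        by_cases hx : x = 0
        · exact Or.inl hx
        · right
          have h2 : B' * x = -(2 * B) := by
            refine mul_left_cancel₀ hx ?_
            linear_combination hC
          linarith
      · exact Or.inr ⟨hy, hC, h⟩
  ext z
  rw [hE]
  rcases eq_or_ne (xA a b) (centre a b c d) with hX | hX
  · have hB' : BxA' a b c d e = 0 := by rw [hX] at h1; linarith
    have hC : onC0 a b c d e z ↔ z.re = xA a b := by
      rw [← sub_eq_zero (a := z.re)]
      simp [onC0, hB', hB.ne']
    rw [hC, ← h2, ← hX, arc_eq_segment hk, mem_segment_vertical_iff hk]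
    refine and_congr_right fun h => ?_
    rw [h, mul_le_mul_iff_right₀ hD]
    simp
  · rw [mem_arc_iff hk hX]
    unfold onC0
    rw [show z.re - centre a b c d = (z.re - xA a b) - (centre a b c d - xA a b) by ring,
      ← neg_sub (centre a b c d) (xA a b)]
    have hh := sub_ne_zero.2 hX.symm
    generalize centre a b c d - xA a b = h at *
    generalize halfHeight a b c d e = k at *
    generalize z.re - xA a b = x at *
    generalize z.im = y at *
    generalize BxA a b c d e = B at *
    generalize BxA' a b c d e = B' at *
    generalize a ^ 2 + 4 * c = D at *
    have hM : 0 < h ^ 2 + k ^ 2 := by positivity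
    have hC : B' * (x ^ 2 + y ^ 2) + 2 * B * x = 0 ↔
        (x ^ 2 + y ^ 2) * h = (h ^ 2 + k ^ 2) * x := by
      constructor
      · intro h3
        refine mul_left_cancel₀ hD.ne' ?_
        linear_combination -2 * h3 + (x ^ 2 + y ^ 2) * h1 - x * h2
      · intro h3
        linear_combination -D / 2 * h3 + (x ^ 2 + y ^ 2) / 2 * h1 - x / 2 * h2
    rw [hC, ← h2, mul_le_mul_iff_right₀ hD]
    exact and_congr_right fun h3 => le_iff_of_mul_eq_mul hh hM h3

/-- Now `B < 0` and `Δ ≤ 0` on all of `ℝ`, which contributes the real axis. Dividing by `D < 0`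
reverses the inequality and selects the complementary arc, the one through `x_C`. -/
theorem equimodularSet_eq_arcC_union {a b c d e : ℝ} (ha : a ≠ 0) (hd : discDelta a b c d e < 0)
    (hD : a ^ 2 + 4 * c < 0) :
    equimodularSet a b c d e = arcC a b c d e ∪ Set.range (fun x : ℝ => (x : ℂ)) := by
  have h1 := centre_sub b c d e ha hD.ne
  have h2 := centre_sq_add ha hd
  have hk := halfHeight_pos hd
  rw [arcC, xDeltaPlus_eq hd, xDeltaMinus_eq hd]
  rw [discDelta_eq] at hd
  have hB : BxA a b c d e < 0 := by
    by_contra! h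
    nlinarith [sq_nonneg (BxA' a b c d e)]
  have hreal (z : ℂ) : z ∈ Set.range (fun x : ℝ => (x : ℂ)) ↔ z.im = 0 :=
    ⟨by rintro ⟨x, rfl⟩; exact Complex.ofReal_im x, fun h => ⟨z.re, Complex.ext rfl h.symm⟩⟩
  have hE (z : ℂ) : z ∈ equimodularSet a b c d e ↔ (onC0 a b c d e z ∧
      (a ^ 2 + 4 * c) * ((z.re - xA a b) ^ 2 + z.im ^ 2) ≤ 4 * BxA a b c d e) ∨ z.im = 0 := by
    rw [mem_equimodularSet_iff ha, ← sub_eq_zero (a := z.re)]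
    unfold onC0
    generalize z.re - xA a b = x
    generalize z.im = y
    generalize BxA a b c d e = B at *
    generalize BxA' a b c d e = B' at *
    generalize a ^ 2 + 4 * c = D at *
    have hneg (x : ℝ) : D * x ^ 2 + 4 * B' * x + 4 * B ≤ 0 := by
      by_contra! h
      nlinarith [sq_nonneg (D * x + 2 * B')]
    by_cases hy : y = 0
    · simp [hy, hneg]
    · simp [hy]
  ext z
  rw [Set.mem_union, hreal, hE]
  refine or_congr_left ?_
  split_ifs with hB'
  · have hX : centre a b c d - xA a b = 0 := by
      rw [hB', mul_zero] at h1
      exact (mul_eq_zero.1 h1).resolve_left hD.ne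
    have hC : onC0 a b c d e z ↔ z.re = xA a b := by
      rw [← sub_eq_zero (a := z.re)]
      simp [onC0, hB', hB.ne]
    rw [mem_arcThroughInfinity_iff hk, hC, ← h2, sub_eq_zero.1 hX]
    refine and_congr_right fun h => ?_
    rw [h, mul_le_mul_left_of_neg hD]
    simp
  · have hr : BxA' a b c d e * radius a b c d e = BxA a b c d e := by
      rw [radius, mul_div_cancel₀ _ hB']
    have hxC : xC a b c d e = xA a b - 2 * radius a b c d e := rfl
    -- The power of the chord's midpoint with respect to `C₀`: it is negative, so the midpoint lies
    -- strictly between `x_A` and `x_C`.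
    have hM : (centre a b c d - xA a b) *
        (centre a b c d - xA a b + 2 * radius a b c d e) = -halfHeight a b c d e ^ 2 := by
      refine mul_left_cancel₀ hD.ne ?_
      linear_combination h2 + 2 * radius a b c d e * h1 - 4 * hr
    have hhr : (centre a b c d - xA a b) *
        (centre a b c d - xA a b + 2 * radius a b c d e) < 0 := by
      rw [hM]
      exact neg_lt_zero.2 (by positivity)
    have hne : centre a b c d - xA a b + 2 * radius a b c d e ≠ 0 := right_ne_zero_of_mul hhr.ne
    have hX : xC a b c d e ≠ centre a b c d := by
      rw [hxC]
      intro h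
      apply hne
      linarith
    rw [mem_arc_iff hk hX, hxC, ← h2]
    unfold onC0
    rw [← hr, mul_le_mul_left_of_neg hD]
    rw [show z.re - (xA a b - 2 * radius a b c d e) = z.re - xA a b + 2 * radius a b c d e by ring,
      show centre a b c d - (xA a b - 2 * radius a b c d e) =
        centre a b c d - xA a b + 2 * radius a b c d e by ring,
      show z.re - centre a b c d = z.re - xA a b - (centre a b c d - xA a b) by ring,
      show xA a b - 2 * radius a b c d e - centre a b c d =
        -(2 * radius a b c d e) - (centre a b c d - xA a b) by ring,
      ← mul_nonpos_iff_of_sq_add_neg hhr]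
    generalize centre a b c d - xA a b = h at *
    generalize halfHeight a b c d e = k at *
    generalize radius a b c d e = r at *
    generalize z.re - xA a b = x at *
    generalize z.im = y at *
    generalize BxA' a b c d e = B' at *
    have hC : B' * (x ^ 2 + y ^ 2) + 2 * (B' * r) * x = 0 ↔ x ^ 2 + y ^ 2 = -(2 * r * x) := by
      constructor
      · intro h3
        refine mul_left_cancel₀ hB' ?_
        linear_combination h3
      · intro h3
        linear_combination B' * h3
    have hC' : ((x + 2 * r) ^ 2 + y ^ 2) * (h + 2 * r) = ((h + 2 * r) ^ 2 + k ^ 2) * (x + 2 * r) ↔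
        x ^ 2 + y ^ 2 = -(2 * r * x) := by
      constructor
      · intro h3
        refine mul_left_cancel₀ hne ?_
        linear_combination h3 + (x + 2 * r) * hM
      · intro h3
        linear_combination (h + 2 * r) * h3 - (x + 2 * r) * hM
    rw [hC, hC']
    refine and_congr_right fun h3 => ?_
    have h4 : h ^ 2 + k ^ 2 = -(2 * r * h) := by linear_combination hM
    rw [h3, h4]
    constructor <;> intro h5 <;> linarith

end ClubSet

end

theorem mainTheorem1 (a b c d e : ℝ) (hac : a * c ≠ 0) (W : ℕ → Polynomial ℂ)
    (hW : ClubSet.IsGeneral a b c d e W) :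
    (ClubSet.discDelta a b c d e < 0 →
      {z : ℂ | Polynomial.aeval z (ClubSet.polyDelta a b c d e) = 0} =
          {ClubSet.xDeltaMinus a b c d e, ClubSet.xDeltaPlus a b c d e} ∧
      (0 < a ^ 2 + 4 * c →
        ClubSet.nonIsolatedLimits W =
          ClubSet.arc (ClubSet.xDeltaMinus a b c d e) (ClubSet.xA a b : ℂ)
            (ClubSet.xDeltaPlus a b c d e)) ∧
      (a ^ 2 + 4 * c < 0 →
        ClubSet.nonIsolatedLimits W =
          ClubSet.arcC a b c d e ∪ Set.range (fun x : ℝ => (x : ℂ)))) ∧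
    (0 ≤ ClubSet.discDelta a b c d e →
      (ClubSet.BxA a b c d e < 0 →
        ClubSet.nonIsolatedLimits W = ClubSet.JDelta a b c d e) ∧
      (0 < ClubSet.BxA a b c d e →
        ClubSet.nonIsolatedLimits W =
          ClubSet.JDelta a b c d e ∪ ClubSet.C0 a b c d e)) := by
  have ha := left_ne_zero_of_mul hac
  rw [ClubSet.nonIsolatedLimits_eq ha hW]
  exact ⟨fun hd => ⟨ClubSet.zeros_polyDelta ha hd, ClubSet.equimodularSet_eq_arc ha hd,
      ClubSet.equimodularSet_eq_arcC_union ha hd⟩,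
    fun hd => ⟨ClubSet.equimodularSet_eq_JDelta ha hd,
      ClubSet.equimodularSet_eq_JDelta_union ha hd⟩⟩
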